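/- Let $K$ be a field of characteristic zero and let $A$ be a finite-dimensional (left) Leibniz algebra over $K$, i.e. a $K$-vector space with a bilinear product satisfying $x(yz)=(xy)z+y(xz)$ for all $x,y,z\in A$. The Frattini subalgebra $F(A)$ is the intersection of all maximal subalgebras of $A$ (with $F(A)=A$ if $A = 0$), and the Frattini ideal $\Phi(A)$ is the largest two-sided ideal of $A$ contained in $F(A)$. Let $\mathrm{Asoc}(A)$ denote the sum of all minimal (two-sided, nonzero) ideals $B$ of $A$ that are abelian, i.e. $B\cdot B=0$. For an algebra $V$ let $Z(V)=\{x\in V : xv=0=vx \text{ for all } v\in V\}$ be its center. If $\Phi(A)=0$, then there is a subalgebra $V$ of $A$ such that $A$ is the semidirect sum $A=\mathrm{Asoc}(A)\dotplus V$ (that is, $\mathrm{Asoc}(A)$ is an ideal of $A$ and $A$ is the direct sum of the subspaces $\mathrm{Asoc}(A)$ and $V$), and such that $V=S\oplus Z(V)$ is a direct sum of ideals of $V$, where $S$ is a semisimple Lie algebra (possibly zero). -/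

import Mathlib

/-!
Leibniz algebras over a field `K` are represented as (not necessarily associative or unital)
`K`-algebras `A`: `[NonUnitalNonAssocRing A] [Module K A] [IsScalarTower K A A]
[SMulCommClass K A A]`, satisfying the left Leibniz identity.  Subalgebras are Mathlib's
`NonUnitalSubalgebra K A`; ideals are two-sided and are `K`-subspaces.
-/

namespace Leibniz

/-- The (left) Leibniz identity `x(yz) = (xy)z + y(xz)`: left multiplications are derivations. -/
def IsLeibniz (A : Type*) [NonUnitalNonAssocRing A] : Prop :=
  ∀ x y z : A, x * (y * z) = (x * y) * z + y * (x * z)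

/-- A product is a Lie product if it is alternating and satisfies the Jacobi identity. -/
structure IsLie (A : Type*) [NonUnitalNonAssocRing A] : Prop where
  mul_self : ∀ x : A, x * x = 0
  jacobi : ∀ x y z : A, x * (y * z) + y * (z * x) + z * (x * y) = 0

theorem IsLie.mul_comm_neg {A : Type*} [NonUnitalNonAssocRing A] (h : IsLie A) (x y : A) :
    y * x = -(x * y) := by
  have := h.mul_self (x + y)
  rw [mul_add, add_mul, add_mul, h.mul_self, h.mul_self, zero_add, add_zero] at this
  exact eq_neg_of_add_eq_zero_left this

/-- The Lie ring with bracket `⁅x, y⁆ = x * y`. -/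
abbrev IsLie.toLieRing {A : Type*} [NonUnitalNonAssocRing A] (h : IsLie A) : LieRing A where
  bracket x y := x * y
  add_lie x y z := add_mul x y z
  lie_add x y z := mul_add x y z
  lie_self x := h.mul_self x
  leibniz_lie x y z := by
    have h1 := h.jacobi x y z
    rw [h.mul_comm_neg x z, h.mul_comm_neg (x * y) z, mul_neg] at h1
    have h2 : x * (y * z) - ((x * y) * z + y * (x * z)) = 0 := by rw [← h1]; abel
    exact sub_eq_zero.mp h2

/-- The Lie algebra with bracket `⁅x, y⁆ = x * y`. -/
abbrev IsLie.toLieAlgebra (K : Type*) {A : Type*} [Field K] [NonUnitalNonAssocRing A]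
    [Module K A] [SMulCommClass K A A] (h : IsLie A) :
    letI := h.toLieRing
    LieAlgebra K A :=
  letI := h.toLieRing
  { lie_smul := fun t x y => mul_smul_comm t x y }

/-- The algebra `A` is a semisimple Lie algebra. -/
def IsSemisimpleLie (K A : Type*) [Field K] [NonUnitalNonAssocRing A] [Module K A]
    [SMulCommClass K A A] : Prop :=
  ∃ h : IsLie A,
    letI := h.toLieRing
    letI := h.toLieAlgebra K
    LieAlgebra.IsSemisimple K A

section

variable {K A : Type*} [Field K] [NonUnitalNonAssocRing A] [Module K A]

/-- Two-sided ideals. -/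
def IsIdeal (I : Submodule K A) : Prop :=
  ∀ a : A, ∀ b ∈ I, a * b ∈ I ∧ b * a ∈ I

/-- Minimal ideals: minimal among the nonzero ideals. -/
def IsMinimalIdeal (B : Submodule K A) : Prop :=
  IsIdeal B ∧ B ≠ ⊥ ∧ ∀ I : Submodule K A, IsIdeal I → I ≤ B → I ≠ ⊥ → I = B

/-- The product vanishes on `B`. -/
def IsAbelian (B : Submodule K A) : Prop :=
  ∀ x ∈ B, ∀ y ∈ B, x * y = 0

/-- `A = I ∔ V`, the semidirect sum of an ideal `I` and a subalgebra `V`. -/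
def IsSemidirectSum (I : Submodule K A) (V : NonUnitalSubalgebra K A) : Prop :=
  IsIdeal I ∧ IsCompl I V.toSubmodule

/-- `A = I ⊕ J`, the direct sum of two ideals. -/
def IsDirectSum (I J : Submodule K A) : Prop :=
  IsIdeal I ∧ IsIdeal J ∧ IsCompl I J

end

section

variable (K A : Type*) [Field K] [NonUnitalNonAssocRing A] [Module K A]

/-- The abelian socle `Asoc(A)`: the sum of all abelian minimal ideals. -/
def asoc : Submodule K A :=
  sSup {B : Submodule K A | IsMinimalIdeal B ∧ IsAbelian B}

/-- The center `Z(A) = {x | xa = 0 = ax for all a}`. -/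
def center [IsScalarTower K A A] [SMulCommClass K A A] : Submodule K A where
  carrier := {x | ∀ a : A, x * a = 0 ∧ a * x = 0}
  zero_mem' a := by simp
  add_mem' hx hy a := by simp [add_mul, mul_add, hx a, hy a]
  smul_mem' c x hx a := by simp [smul_mul_assoc, mul_smul_comm, hx a]

variable [IsScalarTower K A A] [SMulCommClass K A A]

/-- The Frattini subalgebra `F(A)`: the intersection of all maximal (proper) subalgebras. -/
def frattiniSubalgebra : NonUnitalSubalgebra K A :=
  sInf {M : NonUnitalSubalgebra K A | IsCoatom M}

/-- The Frattini ideal `Φ(A)`: the largest ideal contained in the Frattini subalgebra. -/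
def frattiniIdeal : Submodule K A :=
  sSup {I : Submodule K A | IsIdeal I ∧ I ≤ (frattiniSubalgebra K A).toSubmodule}

theorem isGreatest_frattiniIdeal :
    IsGreatest {I : Submodule K A | IsIdeal I ∧ I ≤ (frattiniSubalgebra K A).toSubmodule}
      (frattiniIdeal K A) := by
  refine ⟨⟨fun a b hb => ?_, sSup_le fun I hI => hI.2⟩, fun I hI => le_sSup hI⟩
  have hl : frattiniIdeal K A ≤ (frattiniIdeal K A).comap (LinearMap.mulLeft K a) :=
    sSup_le fun I hI x hx => le_sSup (a := I) hI (hI.1 a x hx).1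
  have hr : frattiniIdeal K A ≤ (frattiniIdeal K A).comap (LinearMap.mulRight K a) :=
    sSup_le fun I hI x hx => le_sSup (a := I) hI (hI.1 a x hx).2
  exact ⟨hl hb, hr hb⟩

end

end Leibniz

/-!
Let `Φ(A) = 0`. A minimal supplement of an abelian ideal by a subalgebra is then a complement
(`Leibniz.exists_isCompl_of_isAbelian`), and it follows that `Asoc(A)` is the largest abelian ideal
(`Leibniz.le_asoc_of_isAbelian`). In particular `A = Asoc(A) ∔ V` for a subalgebra `V`. The squares
span an abelian ideal, so they lie in `Asoc(A)`, and `V` is a Lie algebra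
(`Leibniz.IsLeibniz.isLie_of_isCompl_asoc`).

It remains to see that `V` is reductive. On a minimal ideal the right multiplications are zero or
the negatives of the left ones (`Leibniz.IsLeibniz.mul_eq_zero_or_mul_eq_neg`). Hence each abelian
minimal ideal is an irreducible `V`-module, and an ideal of `V` that annihilates all of them from
the left annihilates `Asoc(A)` on both sides. If that ideal is also abelian, it is an abelian ideal
of `A` inside `V`, hence zero.

This applies to two kinds of ideals `D` of `V`: to `[V, J]` for an abelian ideal `J`, and to
`[V, V] ∩ Z(V)`. In both cases `D ≤ [V, J]` and `[D, J] = 0` for an ideal `J` (in the second case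
`J = V`). A trace computation shows that the elements of `D` act nilpotently on every module, and
by Engel's theorem `D` acts trivially on every irreducible one
(`LieAlgebra.lie_eq_zero_of_isIrreducible`). So abelian ideals of `V` are central and
`[V, V] ∩ Z(V) = 0`. It follows that solvable ideals are central, and by Cartan's criterion the
kernel of the Killing form is central. A dimension count for the Killing form gives
`V = [V, V] ⊕ Z(V)`, and the Killing form of `[V, V]` is nondegenerate.
-/

/-! ### A trace criterion for nilpotency -/

open Polynomial in
/-- An endomorphism `f` with `tr (f p(f)) = 0` for all polynomials `p` is nilpotent: the projection
onto its Fitting one-component is of the form `f p(f)`, and its trace is its rank. -/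
theorem LinearMap.isNilpotent_of_trace_mul_aeval_eq_zero {K M : Type*} [Field K] [CharZero K]
    [AddCommGroup M] [Module K M] [FiniteDimensional K M] (f : Module.End K M)
    (h : ∀ p : K[X], LinearMap.trace K M (f * aeval f p) = 0) : IsNilpotent f := by
  obtain ⟨q, hq, hcop⟩ := exists_eq_pow_rootMultiplicity_mul_and_not_dvd (minpoly K f)
    (minpoly.ne_zero (Algebra.IsIntegral.isIntegral f)) 0
  rw [map_zero, sub_zero] at hq hcop
  generalize (minpoly K f).rootMultiplicity 0 = k at hq
  have hX : IsCoprime (X ^ (k + 1)) q :=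
    ((Polynomial.irreducible_X.coprime_iff_not_dvd).mpr hcop).pow_left
  obtain ⟨u, v, huv⟩ := hX
  have hdvd (r : K[X]) (hr : X ^ k * q ∣ r) : aeval f r = 0 := by
    rw [← hq] at hr
    obtain ⟨t, rfl⟩ := hr
    rw [map_mul, minpoly.aeval, zero_mul]
  -- By the Bézout identity `huv`, `e` is the projection onto the Fitting one-component of `f`.
  obtain ⟨e, he⟩ : ∃ e, e = aeval f (u * X ^ (k + 1)) := ⟨_, rfl⟩
  have hid : IsIdempotentElem e := by
    have hp : u * X ^ (k + 1) * (u * X ^ (k + 1)) - u * X ^ (k + 1) =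
        -(X ^ k * q) * (X * u * v) := by
      linear_combination (u * X ^ (k + 1)) * huv
    have h1 : e * e - e = aeval f (-(X ^ k * q) * (X * u * v)) := by
      rw [he, ← map_mul, ← map_sub, hp]
    rw [hdvd _ ((dvd_neg.mpr dvd_rfl).mul_right _)] at h1
    exact sub_eq_zero.mp h1
  have htr : LinearMap.trace K M e = 0 := by
    rw [← h (u * X ^ k), he, show u * X ^ (k + 1) = X * (u * X ^ k) by ring, map_mul, aeval_X]
  have hr := LinearMap.IsProj.trace (LinearMap.isProj_range_iff_isIdempotentElem e |>.mpr hid)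
  rw [htr, eq_comm, Nat.cast_eq_zero, Submodule.finrank_eq_zero, LinearMap.range_eq_bot] at hr
  refine ⟨k, ?_⟩
  calc f ^ k = aeval f (X ^ k * (u * X ^ (k + 1)) + X ^ k * q * v) := by
        rw [show X ^ k * (u * X ^ (k + 1)) + X ^ k * q * v = X ^ k by
          linear_combination X ^ k * huv, map_pow, aeval_X]
    _ = 0 := by rw [map_add, map_mul, ← he, hr, mul_zero, hdvd _ (Dvd.intro _ rfl), add_zero]

/-! ### Lie algebras without degenerate ideals -/

namespace LieAlgebra

open LieModule LieSubmodule

section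

variable {K L : Type*} [Field K] [CharZero K] [LieRing L] [LieAlgebra K L]

open Polynomial in
/-- If `x ∈ [L, J]` centralizes the ideal `J`, then `x` acts nilpotently on every finite-dimensional
module: `p(x)` commutes with each `a ∈ J`, so `tr ([v, a] p(x)) = tr (v [a, p(x)]) = 0`. -/
theorem isNilpotent_toEnd_of_mem_lie {M : Type*} [AddCommGroup M] [Module K M]
    [FiniteDimensional K M] [LieRingModule L M] [LieModule K L M] (J : LieIdeal K L) {x : L}
    (hx : x ∈ ⁅(⊤ : LieIdeal K L), J⁆) (hxJ : ∀ a ∈ J, ⁅x, a⁆ = 0) :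
    IsNilpotent (toEnd K L M x) := by
  refine LinearMap.isNilpotent_of_trace_mul_aeval_eq_zero _ fun p => ?_
  have hcomm (a : L) (ha : a ∈ J) : Commute (toEnd K L M a) (aeval (toEnd K L M x) p) := by
    have h : Commute (toEnd K L M x) (toEnd K L M a) := by
      ext m
      simp [leibniz_lie x a m, hxJ a ha]
    exact (Algebra.commute_of_mem_adjoin_singleton_of_commute (aeval_mem_adjoin_singleton K _)
      h.symm)
  generalize aeval (toEnd K L M x) p = y at hcomm
  clear hxJ
  rw [← LieSubmodule.mem_toSubmodule, lieIdeal_oper_eq_linear_span'] at hx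
  induction hx using Submodule.span_induction with
  | zero => simp
  | add u v _ _ hu hv => rw [map_add, add_mul, map_add, hu, hv, add_zero]
  | smul c u _ hu => rw [map_smul, smul_mul_assoc, map_smul, hu, smul_zero]
  | mem u hu =>
    obtain ⟨v, -, a, ha, rfl⟩ := hu
    have h : toEnd K L M ⁅v, a⁆ =
        toEnd K L M v * toEnd K L M a - toEnd K L M a * toEnd K L M v := by
      ext m
      simp
    rw [h, sub_mul, mul_assoc, mul_assoc, (hcomm a ha).eq, map_sub,
      LinearMap.trace_mul_comm K (toEnd K L M a), ← mul_assoc, mul_assoc _ y, sub_self]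

/-- By Engel's theorem such an ideal `D` has a nonzero space of invariants, which is a submodule
because `D` is an ideal. -/
theorem lie_eq_zero_of_isIrreducible {M : Type*} [AddCommGroup M] [Module K M]
    [FiniteDimensional K M] [LieRingModule L M] [LieModule K L M] [IsIrreducible K L M]
    {J D : LieIdeal K L} (hD : D ≤ ⁅(⊤ : LieIdeal K L), J⁆) (hDJ : ⁅D, J⁆ = ⊥)
    {x : L} (hx : x ∈ D) (m : M) : ⁅x, m⁆ = 0 := by
  rw [lie_eq_bot_iff] at hDJ
  have hnil : LieModule.IsNilpotent D M := (isNilpotent_iff_forall' (R := K)).mpr fun d =>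
    isNilpotent_toEnd_of_mem_lie J (hD d.2) (hDJ d d.2)
  have : Nontrivial M := nontrivial_of_isIrreducible K L M
  obtain ⟨⟨m₀, hm₀⟩, hne⟩ := @exists_ne _ (nontrivial_max_triv_of_isNilpotent K D M) 0
  let N : LieSubmodule K L M :=
    { carrier := {m | ∀ d ∈ D, ⁅d, m⁆ = 0}
      zero_mem' := by simp
      add_mem' := fun ha hb d hd => by rw [lie_add, ha d hd, hb d hd, add_zero]
      smul_mem' := fun c a ha d hd => by rw [lie_smul, ha d hd, smul_zero]
      lie_mem := fun {y a} ha d hd => by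
        rw [leibniz_lie, ha d hd, lie_zero, add_zero, ← lie_skew, neg_lie,
          ha _ (LieSubmodule.lie_mem _ hd), neg_zero] }
  have hN : N ≠ ⊥ := fun h => hne <| Subtype.ext <| by
    have : m₀ ∈ N := fun d hd => (mem_maxTrivSubmodule K D M m₀).mp hm₀ ⟨d, hd⟩
    rwa [h, LieSubmodule.mem_bot] at this
  have : m ∈ N := by rw [(eq_bot_or_eq_top N).resolve_left hN]; exact LieSubmodule.mem_top m
  exact this x hx

end

section

variable (K L : Type*) [Field K] [LieRing L] [LieAlgebra K L]

/-- Call an ideal `D` *degenerate* if it is abelian, contained in `[L, J]` for some ideal `J`, and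
annihilated by that `J`. Such ideals act trivially on irreducible modules
(`lie_eq_zero_of_isIrreducible`). The condition is that there are none except `0`; in
characteristic zero it makes `L` reductive. -/
def HasNoDegenerateIdeal : Prop :=
  ∀ J D : LieIdeal K L, D ≤ ⁅(⊤ : LieIdeal K L), J⁆ → ⁅D, J⁆ = ⊥ → ⁅D, D⁆ = ⊥ → D = ⊥

variable {K L}

theorem killingForm_eq_zero_of_mem_center {x : L} (hx : x ∈ center K L) (y : L) :
    killingForm K L y x = 0 := by
  have : ad K L x = 0 := by
    ext z
    rw [ad_apply, ← lie_skew, (mem_maxTrivSubmodule K L L x).mp hx z, neg_zero]; rfl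
  rw [killingForm_apply_apply, this, LinearMap.comp_zero, map_zero]

namespace HasNoDegenerateIdeal

variable (H : HasNoDegenerateIdeal K L)
include H

/-- For an abelian ideal `J`, the ideal `[L, J]` is degenerate. -/
theorem le_center_of_lie_self_eq_bot {J : LieIdeal K L} (hJ : ⁅J, J⁆ = ⊥) : J ≤ center K L := by
  have hle : ⁅(⊤ : LieIdeal K L), J⁆ ≤ J := lie_le_right J ⊤
  have hb := H J _ le_rfl (le_bot_iff.mp ((mono_lie_left J hle).trans hJ.le))
    (le_bot_iff.mp ((mono_lie hle hle).trans hJ.le))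
  rw [lie_eq_bot_iff] at hb
  exact fun x hx => (mem_maxTrivSubmodule K L L x).mpr fun y => hb y (LieSubmodule.mem_top y) x hx

/-- The ideal `[L, L] ∩ Z(L)` is degenerate. -/
theorem disjoint_center : Disjoint ⁅(⊤ : LieIdeal K L), (⊤ : LieIdeal K L)⁆ (center K L) := by
  rw [disjoint_iff]
  have h (I : LieIdeal K L) :
      ⁅⁅(⊤ : LieIdeal K L), (⊤ : LieIdeal K L)⁆ ⊓ center K L, I⁆ = ⊥ := by
    rw [lie_eq_bot_iff]
    intro x hx y _
    rw [← lie_skew, (mem_maxTrivSubmodule K L L x).mp hx.2 y, neg_zero]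
  exact H ⊤ _ inf_le_left (h _) (h _)

/-- Solvable ideals are central. By induction on the derived length `[I, I]` is central, so it lies
in `[L, L] ∩ Z(L) = 0`, and `I` is abelian. -/
theorem le_center_of_derivedSeriesOfIdeal_eq_bot (n : ℕ) (I : LieIdeal K L)
    (hI : derivedSeriesOfIdeal K L n I = ⊥) : I ≤ center K L := by
  induction n generalizing I with
  | zero => rw [derivedSeriesOfIdeal_zero] at hI; rw [hI]; exact bot_le
  | succ n ih =>
    rw [derivedSeriesOfIdeal_add, derivedSeriesOfIdeal_succ, derivedSeriesOfIdeal_zero] at hI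
    refine H.le_center_of_lie_self_eq_bot (le_bot_iff.mp ?_)
    exact H.disjoint_center (mono_lie le_top le_top) (ih _ hI)

variable [FiniteDimensional K L]

theorem radical_le_center : radical K L ≤ center K L := by
  obtain ⟨k, hk⟩ := IsSolvable.solvable K (radical K L)
  exact H.le_center_of_derivedSeriesOfIdeal_eq_bot k _
    ((LieIdeal.derivedSeries_eq_bot_iff _ k).mp hk)

variable [CharZero K]

/-- By Cartan's criterion the kernel of the Killing form is solvable, hence central. -/
theorem mem_center_of_killingForm_eq_zero {x : L} (hx : ∀ y, killingForm K L x y = 0) :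
    x ∈ center K L := by
  refine H.radical_le_center (killingCompl_top_le_radical K L ?_)
  rw [LieIdeal.mem_killingCompl]
  intro y _
  rw [LieModule.traceForm_comm]
  exact hx y

/-- The orthogonal of `[L, L]` for the Killing form lies in `Z(L)`: if `x` is in it, then `[L, x]`
is in the kernel of the form, so in `[L, L] ∩ Z(L) = 0`. Counting dimensions gives
`[L, L] + Z(L) = L`. -/
theorem isCompl_center : IsCompl ⁅(⊤ : LieIdeal K L), (⊤ : LieIdeal K L)⁆ (center K L) := by
  set S := ⁅(⊤ : LieIdeal K L), (⊤ : LieIdeal K L)⁆ with hS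
  rw [← LieSubmodule.isCompl_toSubmodule]
  have hdisj : Disjoint S.toSubmodule (center K L).toSubmodule :=
    LieSubmodule.disjoint_toSubmodule.mpr H.disjoint_center
  refine ⟨hdisj, codisjoint_iff.mpr (Submodule.eq_top_of_finrank_eq ?_)⟩
  have horth : LinearMap.BilinForm.orthogonal (killingForm K L) S.toSubmodule
      ≤ (center K L).toSubmodule := by
    intro x hx
    have hx' (y : L) : ⁅y, x⁆ ∈ center K L := by
      refine H.mem_center_of_killingForm_eq_zero fun z => ?_
      rw [LieModule.traceForm_comm, ← LieModule.traceForm_apply_lie_apply]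
      exact hx _ (lie_mem_lie (LieSubmodule.mem_top z) (LieSubmodule.mem_top y))
    refine (mem_maxTrivSubmodule K L L x).mpr fun y => ?_
    have : ⁅y, x⁆ ∈ S ⊓ center K L :=
      ⟨lie_mem_lie (LieSubmodule.mem_top y) (LieSubmodule.mem_top x), hx' y⟩
    rwa [H.disjoint_center.eq_bot, LieSubmodule.mem_bot] at this
  have h1 := LinearMap.BilinForm.finrank_add_finrank_orthogonal
    (LieModule.traceForm_isSymm K L L).isRefl S.toSubmodule
  have h2 := Submodule.finrank_mono horth
  have h3 := Submodule.finrank_sup_add_finrank_inf_eq S.toSubmodule (center K L).toSubmodule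
  rw [hdisj.eq_bot, finrank_bot] at h3
  have h4 := Submodule.finrank_le (S.toSubmodule ⊔ (center K L).toSubmodule)
  change _ + Module.finrank K (LinearMap.BilinForm.orthogonal (killingForm K L) S.toSubmodule) = _
    at h1
  omega

theorem isKilling_lie_top : 
    IsKilling K (⁅(⊤ : LieIdeal K L), (⊤ : LieIdeal K L)⁆ : LieIdeal K L) := by
  constructor
  rw [LieSubmodule.eq_bot_iff]
  rintro ⟨x, hx⟩ hxS
  rw [LieIdeal.mem_killingCompl] at hxS
  have hxc : x ∈ center K L := by
    refine H.mem_center_of_killingForm_eq_zero fun y => ?_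
    have hy : y ∈ ⁅(⊤ : LieIdeal K L), (⊤ : LieIdeal K L)⁆ ⊔ center K L := by
      rw [H.isCompl_center.sup_eq_top]; exact LieSubmodule.mem_top y
    obtain ⟨s, hs, z, hz, rfl⟩ := (LieSubmodule.mem_sup _ _ _).mp hy
    rw [map_add, killingForm_eq_zero_of_mem_center hz, add_zero, LieModule.traceForm_comm]
    have := hxS ⟨s, hs⟩ (LieSubmodule.mem_top _)
    change killingForm K _ _ _ = 0 at this
    rwa [LieIdeal.killingForm_eq] at this
  have : x ∈ ⁅(⊤ : LieIdeal K L), (⊤ : LieIdeal K L)⁆ ⊓ center K L := ⟨hx, hxc⟩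
  rw [H.disjoint_center.eq_bot, LieSubmodule.mem_bot] at this
  exact Subtype.ext this

end HasNoDegenerateIdeal

end

end LieAlgebra

namespace Leibniz

/-! ### Abelian ideals and the abelian socle -/

section

variable {K A : Type*} [Field K] [NonUnitalNonAssocRing A] [Module K A]

theorem isIdeal_inf {I J : Submodule K A} (hI : IsIdeal I) (hJ : IsIdeal J) : IsIdeal (I ⊓ J) :=
  fun a b hb => ⟨⟨(hI a b hb.1).1, (hJ a b hb.2).1⟩, ⟨(hI a b hb.1).2, (hJ a b hb.2).2⟩⟩

/-- An abelian ideal meets each supplementing subalgebra in an ideal: the intersection is stable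
under the subalgebra and annihilated by the ideal. -/
theorem isIdeal_inf_toSubmodule {I : Submodule K A} (hI : IsIdeal I) (hab : IsAbelian I)
    {V : NonUnitalSubalgebra K A} (h : I ⊔ V.toSubmodule = ⊤) :
    IsIdeal (I ⊓ V.toSubmodule) := by
  rintro a x ⟨hxI, hxV⟩
  refine ⟨⟨(hI a x hxI).1, ?_⟩, ⟨(hI a x hxI).2, ?_⟩⟩ <;>
  obtain ⟨i, hi, v, hv, rfl⟩ := Submodule.mem_sup.mp (h ▸ Submodule.mem_top : a ∈ _)
  · rw [add_mul, hab i hi x hxI, zero_add]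
    exact V.mul_mem hv hxV
  · rw [mul_add, hab x hxI i hi, zero_add]
    exact V.mul_mem hxV hv

theorem exists_isMinimalIdeal_le [FiniteDimensional K A] {I : Submodule K A} (hI : IsIdeal I)
    (hne : I ≠ ⊥) : ∃ B : Submodule K A, IsMinimalIdeal B ∧ B ≤ I := by
  obtain ⟨B, hB⟩ := exists_minimal_of_wellFoundedLT
    (fun B : Submodule K A => IsIdeal B ∧ B ≠ ⊥ ∧ B ≤ I) ⟨I, hI, hne, le_rfl⟩
  exact ⟨B, ⟨hB.prop.1, hB.prop.2.1, fun J hJ hJB hJ0 =>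
    le_antisymm hJB (hB.le_of_le ⟨hJ, hJ0, hJB.trans hB.prop.2.2⟩ hJB)⟩, hB.prop.2.2⟩

variable [IsScalarTower K A A] [SMulCommClass K A A]

theorem isIdeal_span_of_forall {s : Set A}
    (h : ∀ x ∈ s, ∀ a, a * x ∈ Submodule.span K s ∧ x * a ∈ Submodule.span K s) :
    IsIdeal (Submodule.span K s) := by
  intro a b hb
  have hl : Submodule.span K s ≤ (Submodule.span K s).comap (LinearMap.mulLeft K a) :=
    Submodule.span_le.mpr fun x hx => (h x hx a).1
  have hr : Submodule.span K s ≤ (Submodule.span K s).comap (LinearMap.mulRight K a) :=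
    Submodule.span_le.mpr fun x hx => (h x hx a).2
  exact ⟨hl hb, hr hb⟩

theorem isIdeal_asoc : IsIdeal (asoc K A) := by
  intro a b hb
  have hl : asoc K A ≤ (asoc K A).comap (LinearMap.mulLeft K a) :=
    sSup_le fun I hI x hx => le_sSup (a := I) hI (hI.1.1 a x hx).1
  have hr : asoc K A ≤ (asoc K A).comap (LinearMap.mulRight K a) :=
    sSup_le fun I hI x hx => le_sSup (a := I) hI (hI.1.1 a x hx).2
  exact ⟨hl hb, hr hb⟩

/-- Distinct minimal ideals intersect, and hence multiply, to zero. -/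
theorem isAbelian_asoc : IsAbelian (asoc K A) := by
  have key (B C : Submodule K A) (hB : IsMinimalIdeal B ∧ IsAbelian B)
      (hC : IsMinimalIdeal C ∧ IsAbelian C) (x : A) (hx : x ∈ B) (y : A) (hy : y ∈ C) :
      x * y = 0 := by
    by_cases h : B ⊓ C = ⊥
    · rw [← Submodule.mem_bot K, ← h]
      exact ⟨(hB.1.1 y x hx).2, (hC.1.1 x y hy).1⟩
    · have hBC := isIdeal_inf hB.1.1 hC.1.1
      rw [← hB.1.2.2 _ hBC inf_le_left h, hC.1.2.2 _ hBC inf_le_right h] at hx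
      exact hC.2 x hx y hy
  intro x hx y hy
  have h1 : asoc K A ≤ LinearMap.ker (LinearMap.mulRight K y) := sSup_le fun B hB x hx => by
    have h2 : asoc K A ≤ LinearMap.ker (LinearMap.mulLeft K x) := sSup_le fun C hC y hy =>
      key B C hB hC x hx y hy
    exact h2 hy
  exact h1 hx

variable [FiniteDimensional K A]

/-- A subalgebra `V` that is minimal among those with `I + V = A` is a complement: otherwise the
ideal `I ∩ V` is missed by a maximal subalgebra `M`, and `V ∩ M` is a smaller supplement. -/
theorem exists_isCompl_of_isAbelian (hΦ : frattiniIdeal K A = ⊥) {I : Submodule K A}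
    (hI : IsIdeal I) (hab : IsAbelian I) :
    ∃ V : NonUnitalSubalgebra K A, IsCompl I V.toSubmodule := by
  obtain ⟨W, hW⟩ := exists_minimal_of_wellFoundedLT
    (fun W : Submodule K A => ∃ V : NonUnitalSubalgebra K A, V.toSubmodule = W ∧ I ⊔ W = ⊤)
    ⟨⊤, ⊤, NonUnitalAlgebra.top_toSubmodule, sup_top_eq I⟩
  obtain ⟨V, rfl, hV⟩ := hW.prop
  refine ⟨V, disjoint_iff.mpr ?_, codisjoint_iff.mpr hV⟩
  by_contra hne
  have hC := isIdeal_inf_toSubmodule hI hab hV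
  set C := I ⊓ V.toSubmodule
  obtain ⟨M, hM, hCM⟩ : ∃ M : NonUnitalSubalgebra K A, IsCoatom M ∧ ¬ C ≤ M.toSubmodule := by
    by_contra! h
    refine hne (le_bot_iff.mp (hΦ ▸ (isGreatest_frattiniIdeal K A).2 ⟨hC, fun x hx => ?_⟩))
    exact NonUnitalAlgebra.mem_sInf.mpr fun M hM => h M hM hx
  let N : NonUnitalSubalgebra K A :=
    { C ⊔ M.toSubmodule with
      mul_mem' := by
        intro a b ha hb
        obtain ⟨c, hc, m, hm, rfl⟩ := Submodule.mem_sup.mp ha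
        obtain ⟨c', hc', m', hm', rfl⟩ := Submodule.mem_sup.mp hb
        rw [add_mul, mul_add m]
        exact add_mem (Submodule.mem_sup_left (hC _ c hc).2)
          (add_mem (Submodule.mem_sup_left (hC m c' hc').1)
            (Submodule.mem_sup_right (M.mul_mem hm hm'))) }
  have hN : N = ⊤ := by
    refine hM.2 N (lt_of_le_of_ne (fun x hx => Submodule.mem_sup_right hx) fun h =>
      hCM fun x hx => ?_)
    rw [h]
    exact Submodule.mem_sup_left hx
  have hle : V.toSubmodule ≤ (V ⊓ M).toSubmodule := by
    refine hW.le_of_le ⟨V ⊓ M, rfl, eq_top_iff.mpr fun a _ => ?_⟩ fun x hx => hx.1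
    obtain ⟨i, hi, v, hv, rfl⟩ := Submodule.mem_sup.mp (hV ▸ Submodule.mem_top : a ∈ _)
    obtain ⟨c, hc, m, hm, rfl⟩ := Submodule.mem_sup.mp
      (show v ∈ C ⊔ M.toSubmodule from (hN ▸ NonUnitalAlgebra.mem_top : v ∈ N))
    rw [← add_assoc]
    refine Submodule.add_mem_sup (add_mem hi hc.1) ⟨?_, hm⟩
    simpa using V.sub_mem hv hc.2
  exact hCM fun x hx => (hle hx.2).2

/-- If `Φ(A) = 0`, the abelian socle contains every abelian ideal `I`: a subalgebra complementing
`I ∩ Asoc(A)` meets `I` in an ideal, which contains no minimal ideal and so vanishes. -/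
theorem le_asoc_of_isAbelian (hΦ : frattiniIdeal K A = ⊥) {I : Submodule K A}
    (hI : IsIdeal I) (hab : IsAbelian I) : I ≤ asoc K A := by
  obtain ⟨V, hV⟩ := exists_isCompl_of_isAbelian hΦ (isIdeal_inf hI isIdeal_asoc)
    fun x hx y hy => hab x hx.1 y hy.1
  have hIV := isIdeal_inf_toSubmodule hI hab
    (top_le_iff.mp (hV.sup_eq_top.ge.trans (sup_le_sup_right inf_le_left V.toSubmodule)))
  have h0 : I ⊓ V.toSubmodule = ⊥ := by
    by_contra hne
    obtain ⟨B, hB, hle⟩ := exists_isMinimalIdeal_le hIV hne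
    have hBs : B ≤ asoc K A :=
      le_sSup ⟨hB, fun x hx y hy => hab x (hle hx).1 y (hle hy).1⟩
    exact hB.2.1 (le_bot_iff.mp (hV.inf_eq_bot ▸
      le_inf (le_inf (hle.trans inf_le_left) hBs) (hle.trans inf_le_right)))
  intro x hx
  obtain ⟨j, hj, v, hv, rfl⟩ := Submodule.mem_sup.mp
    (hV.sup_eq_top ▸ Submodule.mem_top : x ∈ _)
  have : v ∈ I ⊓ V.toSubmodule := ⟨by simpa using sub_mem hx hj.1, hv⟩
  rw [h0, Submodule.mem_bot] at this
  rw [this, add_zero]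
  exact hj.2

end

/-! ### The action on the abelian socle -/

namespace IsLeibniz

variable {K A : Type*} [Field K] [NonUnitalNonAssocRing A] [Module K A]
  (hA : IsLeibniz A)
include hA

theorem mul_mul_eq_sub (x y z : A) : x * y * z = x * (y * z) - y * (x * z) := by
  rw [hA x y z, add_sub_cancel_right]

theorem mul_self_mul (x y : A) : x * x * y = 0 := by
  rw [hA.mul_mul_eq_sub, sub_self]

variable [IsScalarTower K A A] [SMulCommClass K A A]

/-- The span of the squares is an ideal whose left multiplications vanish, hence an abelian
ideal. -/
theorem mul_self_mem_asoc [FiniteDimensional K A] (hΦ : frattiniIdeal K A = ⊥) (x : A) :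
    x * x ∈ asoc K A := by
  have hI : IsIdeal (Submodule.span K (Set.range fun x : A => x * x)) := by
    refine isIdeal_span_of_forall ?_
    rintro _ ⟨x, rfl⟩ a
    have hsq (y : A) : y * y ∈ Submodule.span K (Set.range fun x : A => x * x) :=
      Submodule.subset_span ⟨y, rfl⟩
    refine ⟨?_, by simp only [hA.mul_self_mul, zero_mem]⟩
    have : a * (x * x) = (a * x + x) * (a * x + x) - a * x * (a * x) - x * x := by
      rw [hA a x x, add_mul, mul_add, mul_add]
      abel
    rw [this]
    exact sub_mem (sub_mem (hsq _) (hsq _)) (hsq _)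
  refine le_asoc_of_isAbelian hΦ hI (fun y hy z _ => ?_) (Submodule.subset_span ⟨x, rfl⟩)
  have : Submodule.span K (Set.range fun x : A => x * x) ≤
      LinearMap.ker (LinearMap.mulRight K z) := by
    rw [Submodule.span_le]
    rintro _ ⟨w, rfl⟩
    exact hA.mul_self_mul w z
  exact this hy

/-- On a minimal ideal `B` the right multiplications either vanish or are the negatives of the
left multiplications: the elements `ab + ba` span an ideal inside `B` which is annihilated by
all right multiplications. -/
theorem mul_eq_zero_or_mul_eq_neg {B : Submodule K A} (hB : IsMinimalIdeal B) :
    (∀ b ∈ B, ∀ a, b * a = 0) ∨ ∀ b ∈ B, ∀ a, b * a = -(a * b) := by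
  set s : Set A := {x | ∃ b ∈ B, ∃ a, a * b + b * a = x} with hs
  have hs0 : ∀ x ∈ s, ∀ c, x * c = 0 := by
    rintro _ ⟨b, -, a, rfl⟩ c
    rw [add_mul, hA.mul_mul_eq_sub, hA.mul_mul_eq_sub]
    abel
  have hI : IsIdeal (Submodule.span K s) := by
    refine isIdeal_span_of_forall fun x hx c => ⟨?_, by simp only [hs0 x hx, zero_mem]⟩
    obtain ⟨b, hb, a, rfl⟩ := hx
    have : c * (a * b + b * a) = (c * a * b + b * (c * a)) + (a * (c * b) + c * b * a) := by
      rw [mul_add, hA c a b, hA c b a]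
      abel
    rw [this]
    exact add_mem (Submodule.subset_span ⟨b, hb, c * a, rfl⟩)
      (Submodule.subset_span ⟨c * b, (hB.1 c b hb).1, a, rfl⟩)
  have hle : Submodule.span K s ≤ B := by
    rw [Submodule.span_le]
    rintro _ ⟨b, hb, a, rfl⟩
    exact add_mem (hB.1 a b hb).1 (hB.1 a b hb).2
  by_cases h : Submodule.span K s = ⊥
  · refine Or.inr fun b hb a => ?_
    have := Submodule.subset_span (R := K) (show a * b + b * a ∈ s from ⟨b, hb, a, rfl⟩)
    rw [h] at this
    exact eq_neg_of_add_eq_zero_right this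
  · refine Or.inl fun b hb a => ?_
    have hk : Submodule.span K s ≤ LinearMap.ker (LinearMap.mulRight K a) :=
      Submodule.span_le.mpr fun x hx => hs0 x hx a
    rw [hB.2.2 _ hI hle h] at hk
    exact hk hb

/-- An abelian minimal ideal is irreducible under the left multiplications by a subalgebra `V` with
`Asoc(A) + V = A`. -/
theorem eq_of_forall_mul_mem {B N : Submodule K A} (hB : IsMinimalIdeal B) (hab : IsAbelian B)
    {V : NonUnitalSubalgebra K A} (hV : asoc K A ⊔ V.toSubmodule = ⊤) (hNB : N ≤ B) (hN : N ≠ ⊥)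
    (h : ∀ v ∈ V, ∀ n ∈ N, v * n ∈ N) : N = B := by
  have hl (a : A) (n : A) (hn : n ∈ N) : a * n ∈ N := by
    obtain ⟨i, hi, v, hv, rfl⟩ := Submodule.mem_sup.mp (hV ▸ Submodule.mem_top : a ∈ _)
    have hBs : B ≤ asoc K A := le_sSup ⟨hB, hab⟩
    rw [add_mul, isAbelian_asoc i hi n (hBs (hNB hn)), zero_add]
    exact h v hv n hn
  refine hB.2.2 N (fun a n hn => ⟨hl a n hn, ?_⟩) hNB hN
  rcases hA.mul_eq_zero_or_mul_eq_neg hB with h0 | h0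
  · rw [h0 n (hNB hn) a]; exact zero_mem N
  · rw [h0 n (hNB hn) a]; exact neg_mem (hl a n hn)

theorem isLie_of_isCompl_asoc [FiniteDimensional K A] (hΦ : frattiniIdeal K A = ⊥)
    {V : NonUnitalSubalgebra K A} (hV : IsCompl (asoc K A) V.toSubmodule) : IsLie V := by
  have hsq (x : V) : x * x = 0 := by
    have : (x * x : A) ∈ asoc K A ⊓ V.toSubmodule :=
      ⟨hA.mul_self_mem_asoc hΦ x, V.mul_mem x.2 x.2⟩
    rw [hV.inf_eq_bot, Submodule.mem_bot] at this
    exact Subtype.ext this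
  have hneg (x y : V) : y * x = -(x * y) := by
    have := hsq (x + y)
    rw [mul_add, add_mul, add_mul, hsq, hsq, zero_add, add_zero] at this
    exact eq_neg_of_add_eq_zero_left this
  refine ⟨hsq, fun x y z => ?_⟩
  have h : x * (y * z) = x * y * z + y * (x * z) := Subtype.ext (hA x y z)
  rw [h, hneg x z, hneg (x * y) z, mul_neg]
  abel

variable [CharZero K] [FiniteDimensional K A]

/-- An abelian minimal ideal is an irreducible module of the Lie algebra `V` under left
multiplication, so degenerate ideals of `V` annihilate it from the left. -/
theorem mul_eq_zero_of_mem_minimal {V : NonUnitalSubalgebra K A}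
    (hV : asoc K A ⊔ V.toSubmodule = ⊤) (hL : IsLie V)
    {B : Submodule K A} (hB : IsMinimalIdeal B) (hab : IsAbelian B) :
    letI := hL.toLieRing
    letI := hL.toLieAlgebra K
    ∀ J D : LieIdeal K V, D ≤ ⁅(⊤ : LieIdeal K V), J⁆ → ⁅D, J⁆ = ⊥ →
      ∀ d ∈ D, ∀ b ∈ B, (d : A) * b = 0 := by
  let := hL.toLieRing
  let := hL.toLieAlgebra K
  intro J D hD hDJ d hd b hb
  let : LieRingModule V B :=
    { bracket := fun v b => ⟨v * b, (hB.1 v b b.2).1⟩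
      add_lie := fun v w b => Subtype.ext (add_mul (v : A) w b)
      lie_add := fun v b c => Subtype.ext (mul_add (v : A) b c)
      leibniz_lie := fun v w b => Subtype.ext (hA v w b) }
  let : LieModule K V B :=
    { smul_lie := fun c v b => Subtype.ext (smul_mul_assoc c (v : A) (b : A))
      lie_smul := fun c v b => Subtype.ext (mul_smul_comm c (v : A) (b : A)) }
  have : Nontrivial B := Submodule.nontrivial_iff_ne_bot.mpr hB.2.1
  have : LieModule.IsIrreducible K V B := LieModule.IsIrreducible.mk fun N hN => by
    have hN' : N.toSubmodule.map B.subtype = B := by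
      refine hA.eq_of_forall_mul_mem hB hab hV (Submodule.map_subtype_le _ _) ?_ ?_
      · rw [ne_eq, ← Submodule.map_bot B.subtype,
          (Submodule.map_injective_of_injective B.subtype_injective).eq_iff]
        simpa using hN
      · rintro v hv _ ⟨n, hn, rfl⟩
        exact ⟨_, N.lie_mem (x := ⟨v, hv⟩) hn, rfl⟩
    rw [← LieSubmodule.toSubmodule_eq_top]
    exact Submodule.map_injective_of_injective B.subtype_injective
      (hN'.trans (Submodule.map_subtype_top B).symm)
  exact congrArg Subtype.val (LieAlgebra.lie_eq_zero_of_isIrreducible hD hDJ hd (⟨b, hb⟩ : B))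

/-- A degenerate ideal `D` of `V` annihilates `Asoc(A)` on both sides, so it is an abelian ideal of
`A`, and therefore lies in `Asoc(A) ∩ V = 0`. -/
theorem hasNoDegenerateIdeal (hΦ : frattiniIdeal K A = ⊥) {V : NonUnitalSubalgebra K A}
    (hV : IsCompl (asoc K A) V.toSubmodule) (hL : IsLie V) :
    letI := hL.toLieRing
    letI := hL.toLieAlgebra K
    LieAlgebra.HasNoDegenerateIdeal K V := by
  let := hL.toLieRing
  let := hL.toLieAlgebra K
  intro J D hD hDJ hDD
  have hl (d : V) (hd : d ∈ D) : asoc K A ≤ LinearMap.ker (LinearMap.mulLeft K (d : A)) :=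
    sSup_le fun B hB b hb =>
      hA.mul_eq_zero_of_mem_minimal hV.sup_eq_top hL hB.1 hB.2 J D hD hDJ d hd b hb
  have hr (d : V) (hd : d ∈ D) : asoc K A ≤ LinearMap.ker (LinearMap.mulRight K (d : A)) :=
    sSup_le fun B hB b hb => by
      change b * (d : A) = 0
      rcases hA.mul_eq_zero_or_mul_eq_neg hB.1 with h0 | h0
      · exact h0 b hb d
      · rw [h0 b hb d, neg_eq_zero]
        exact hl d hd (le_sSup (a := B) hB hb)
  have hle : D.toSubmodule.map V.toSubmodule.subtype ≤ asoc K A := by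
    refine le_asoc_of_isAbelian hΦ ?_ ?_
    · rintro a _ ⟨(d : V), hd, rfl⟩
      obtain ⟨i, hi, v, hv, rfl⟩ := Submodule.mem_sup.mp
        (hV.sup_eq_top ▸ Submodule.mem_top : a ∈ _)
      have h1 : i * (d : A) = 0 := hr d hd hi
      have h2 : (d : A) * i = 0 := hl d hd hi
      have h3 : (⟨v, hv⟩ : V) * d ∈ D := D.lie_mem (x := (⟨v, hv⟩ : V)) hd
      have h4 : d * (⟨v, hv⟩ : V) ∈ D := by
        rw [hL.mul_comm_neg ⟨v, hv⟩ d]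
        exact neg_mem h3
      change (i + v) * (d : A) ∈ _ ∧ (d : A) * (i + v) ∈ _
      rw [add_mul, mul_add, h1, h2, zero_add, zero_add]
      exact ⟨⟨_, h3, rfl⟩, ⟨_, h4, rfl⟩⟩
    · rintro _ ⟨d, hd, rfl⟩ _ ⟨e, he, rfl⟩
      exact congrArg Subtype.val ((LieSubmodule.lie_eq_bot_iff _ _).mp hDD d hd e he)
  refine (LieSubmodule.eq_bot_iff _).mpr fun d hd => ?_
  have : (d : A) ∈ asoc K A ⊓ V.toSubmodule := ⟨hle ⟨d, hd, rfl⟩, d.2⟩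
  rw [hV.inf_eq_bot, Submodule.mem_bot] at this
  exact Subtype.ext this

end IsLeibniz

/-! ### The complement as a reductive Lie algebra -/

/-- The summand complementing the center is `[V, V]`, whose Killing form is nondegenerate. -/
theorem IsLie.exists_isDirectSum_center {K V : Type*} [Field K] [CharZero K]
    [NonUnitalNonAssocRing V] [Module K V] [IsScalarTower K V V] [SMulCommClass K V V]
    [FiniteDimensional K V] (hL : IsLie V)
    (H : letI := hL.toLieRing
      letI := hL.toLieAlgebra K
      LieAlgebra.HasNoDegenerateIdeal K V) :
    ∃ S : NonUnitalSubalgebra K V,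
      IsDirectSum S.toSubmodule (center K V) ∧ IsSemisimpleLie K S := by
  let := hL.toLieRing
  let := hL.toLieAlgebra K
  have hcompl := H.isCompl_center
  have hkill := H.isKilling_lie_top
  generalize ⁅(⊤ : LieIdeal K V), (⊤ : LieIdeal K V)⁆ = D at hcompl hkill
  have hmul (x y : V) (hy : y ∈ D) : x * y ∈ D := D.lie_mem (x := x) hy
  -- `D` is `[V, V]`; `S` is `D` as a subalgebra for the product of `V`.
  let S : NonUnitalSubalgebra K V :=
    { D.toSubmodule with mul_mem' := fun {a b} _ hb => hmul a b hb }
  have hcenter : center K V = (LieAlgebra.center K V).toSubmodule := by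
    ext x
    rw [LieSubmodule.mem_toSubmodule, LieModule.mem_maxTrivSubmodule]
    refine ⟨fun h y => (h y).2, fun h y => ⟨?_, h y⟩⟩
    rw [hL.mul_comm_neg y x, neg_eq_zero]
    exact h y
  have hS : IsLie S :=
    ⟨fun x => Subtype.ext (hL.mul_self x), fun x y z => Subtype.ext (hL.jacobi x y z)⟩
  refine ⟨S, ⟨fun a b hb => ⟨hmul a b hb, ?_⟩, fun a b hb => ?_, ?_⟩, hS, ?_⟩
  · rw [hL.mul_comm_neg a b]
    exact neg_mem (S := Submodule K V) (hmul a b hb)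
  · rw [(hb a).1, (hb a).2]
    exact ⟨zero_mem _, zero_mem _⟩
  · rw [hcenter]
    exact LieSubmodule.isCompl_toSubmodule.mpr hcompl
  · let := hS.toLieRing
    let := hS.toLieAlgebra K
    let e : D ≃ₗ⁅K⁆ S :=
      { LinearEquiv.refl K D.toSubmodule with map_lie' := rfl }
    have : LieAlgebra.IsKilling K S := LieAlgebra.isKilling_of_equiv e
    have : FiniteDimensional K S :=
      FiniteDimensional.finiteDimensional_submodule D.toSubmodule
    infer_instance

end Leibniz

theorem mainTheorem11 {K A : Type*} [Field K] [CharZero K]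
    [NonUnitalNonAssocRing A] [Module K A] [IsScalarTower K A A] [SMulCommClass K A A]
    [FiniteDimensional K A] (hA : Leibniz.IsLeibniz A)
    (hΦ : Leibniz.frattiniIdeal K A = ⊥) :
    ∃ V : NonUnitalSubalgebra K A, Leibniz.IsSemidirectSum (Leibniz.asoc K A) V ∧
      ∃ S : NonUnitalSubalgebra K V,
        Leibniz.IsDirectSum S.toSubmodule (Leibniz.center K V) ∧
        Leibniz.IsSemisimpleLie K S := by
  obtain ⟨V, hV⟩ := Leibniz.exists_isCompl_of_isAbelian hΦ Leibniz.isIdeal_asoc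
    Leibniz.isAbelian_asoc
  have hL := hA.isLie_of_isCompl_asoc hΦ hV
  have : FiniteDimensional K V := FiniteDimensional.finiteDimensional_submodule V.toSubmodule
  exact ⟨V, ⟨Leibniz.isIdeal_asoc, hV⟩,
    hL.exists_isDirectSum_center (hA.hasNoDegenerateIdeal hΦ hV hL)⟩
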